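/- Let $p$ be a prime, let $\zeta$ be a primitive $p$-th root of unity, and let $t$ be the standard generator of $\mathbb Z/p$. Call a $\mathbb Z[\mathbb Z/p]$-module $L$ of type $(a,b,0)$ if it is isomorphic to \[ \Big(\bigoplus_{i=1}^{a} M_i\Big)\oplus\Big(\bigoplus_{j=1}^{b} N_j\Big), \] where each $M_i\subseteq\mathbb Q(\zeta)$ is a nonzero fractional ideal of $\mathbb Z[\zeta]$ on which $t$ acts by multiplication by $\zeta$, and each $N_j=B_j\oplus\mathbb Z$ as an abelian group, for a nonzero fractional ideal $B_j\subseteq\mathbb Q(\zeta)$ of $\mathbb Z[\zeta]$ and an element $\beta_j\in B_j\setminus(1-\zeta)B_j$, with action $t\cdot(x,m)=(\zeta x+m\beta_j,\,m)$. Let $a,b\ge 0$ and let $L$ be of type $(a,b,0)$. Then for every $r\ge 0$ and every $n\in\mathbb Z$ there is an isomorphism of Tate cohomology groups \[ \hat H^n\big(\mathbb Z/p;\Lambda^r L\big)\cong\hat H^n\big(\mathbb Z/p;\Lambda^r(\mathbb Z[\zeta]^a\oplus\mathbb Z[\mathbb Z/p]^b)\big), \] where exterior powers are taken over $\mathbb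 Z$ with the diagonal action, $t$ acts on $\mathbb Z[\zeta]$ by multiplication by $\zeta$, and $\mathbb Z/p$ acts on $\mathbb Z[\mathbb Z/p]$ by left multiplication. -/

import Mathlib

open scoped nonZeroDivisors

/-- The group `ℤ/p`, written multiplicatively. Its standard generator `t` is
`Multiplicative.ofAdd 1`. -/
abbrev CyclicGrp (p : ℕ) : Type := Multiplicative (ZMod p)

/-- The representation of `ℤ/p` on an abelian group `V` in which the standard generator acts
by an endomorphism `T` with `T ^ p = 1`. -/
def cyclicRep (p : ℕ) [NeZero p] {V : Type*} [AddCommGroup V] (T : Module.End ℤ V)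
    (hT : T ^ p = 1) : Representation ℤ (CyclicGrp p) V where
  toFun g := T ^ (Multiplicative.toAdd g).val
  map_one' := by simp
  map_mul' g h := by
    rw [toAdd_mul, ZMod.val_add, ← pow_eq_pow_mod _ hT, pow_add]

theorem cyclicRep_generator (p : ℕ) [Fact p.Prime] {V : Type*} [AddCommGroup V]
    (T : Module.End ℤ V) (hT : T ^ p = 1) :
    cyclicRep p T hT (Multiplicative.ofAdd 1) = T := by
  have : Fact (1 < p) := ⟨(Fact.out : p.Prime).one_lt⟩
  change T ^ (1 : ZMod p).val = T
  rw [ZMod.val_one, pow_one]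

/-- Multiplication by `z` on an `S`-module, as an additive endomorphism. -/
def mulEnd {S : Type*} [CommRing S] (z : S) (V : Type*) [AddCommGroup V] [Module S V] :
    Module.End ℤ V :=
  (DistribSMul.toAddMonoidHom V z).toIntLinearMap

@[simp]
theorem mulEnd_apply {S : Type*} [CommRing S] (z : S) {V : Type*} [AddCommGroup V] [Module S V]
    (v : V) : mulEnd z V v = z • v := rfl

theorem mulEnd_pow_apply {S : Type*} [CommRing S] (z : S) {V : Type*} [AddCommGroup V]
    [Module S V] (k : ℕ) (v : V) : (mulEnd z V ^ k) v = z ^ k • v := by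
  induction k with
  | zero => simp
  | succ k ih => rw [pow_succ', Module.End.mul_apply, ih, mulEnd_apply, smul_smul, pow_succ']

/-- The endomorphism `(b, m) ↦ (z b + m b₀, m)` of `V × ℤ`. -/
def extEnd {S : Type*} [CommRing S] (z : S) {V : Type*} [AddCommGroup V] [Module S V] (b₀ : V) :
    Module.End ℤ (V × ℤ) :=
  AddMonoidHom.toIntLinearMap
    { toFun := fun x => (z • x.1 + x.2 • b₀, x.2)
      map_zero' := by simp
      map_add' := fun x y => by
        ext
        · simp only [Prod.fst_add, Prod.snd_add, smul_add, add_smul]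
          abel
        · rfl }

@[simp]
theorem extEnd_apply {S : Type*} [CommRing S] (z : S) {V : Type*} [AddCommGroup V] [Module S V]
    (b₀ : V) (x : V × ℤ) : extEnd z b₀ x = (z • x.1 + x.2 • b₀, x.2) := rfl

theorem extEnd_pow_apply {S : Type*} [CommRing S] (z : S) {V : Type*} [AddCommGroup V]
    [Module S V] (b₀ : V) (k : ℕ) (x : V × ℤ) :
    (extEnd z b₀ ^ k) x
      = (z ^ k • x.1 + x.2 • (∑ i ∈ Finset.range k, z ^ i) • b₀, x.2) := by
  induction k with
  | zero => simp
  | succ k ih =>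
    rw [pow_succ', Module.End.mul_apply, ih, extEnd_apply, Finset.sum_range_succ']
    ext
    · simp only [smul_add, add_smul, smul_smul, pow_succ', pow_zero, one_smul,
        ← Finset.mul_sum, smul_comm z x.2]
      abel
    · rfl

/-- The ring `ℤ[ζ]`, as a subring of the field `K` containing `ζ`. -/
abbrev ZZeta {K : Type} [Field K] (ζ : K) : Type := Algebra.adjoin ℤ ({ζ} : Set K)

/-- The element `ζ` of `ℤ[ζ]`. -/
def zetaElt {K : Type} [Field K] (ζ : K) : ZZeta ζ :=
  ⟨ζ, Algebra.self_mem_adjoin_singleton ℤ ζ⟩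

theorem zetaElt_pow {K : Type} [Field K] {ζ : K} {p : ℕ} (hζ : IsPrimitiveRoot ζ p) :
    zetaElt ζ ^ p = 1 :=
  Subtype.ext hζ.pow_eq_one

theorem zetaElt_geom_sum {K : Type} [Field K] {ζ : K} {p : ℕ} [Fact p.Prime]
    (hζ : IsPrimitiveRoot ζ p) : ∑ i ∈ Finset.range p, zetaElt ζ ^ i = 0 := by
  apply Subtype.ext
  have h := hζ.geom_sum_eq_zero (Fact.out : p.Prime).one_lt
  simpa [zetaElt] using h

section Reps

variable {p : ℕ} [Fact p.Prime] {K : Type} [Field K] {ζ : K} (hζ : IsPrimitiveRoot ζ p)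

/-- The representation of `ℤ/p` on a `ℤ[ζ]`-module `V` in which the standard generator acts by
multiplication by `ζ`. -/
def zetaRep (V : Type*) [AddCommGroup V] [Module (ZZeta ζ) V] :
    Representation ℤ (CyclicGrp p) V :=
  cyclicRep p (mulEnd (zetaElt ζ) V) <| LinearMap.ext fun v => by
    rw [mulEnd_pow_apply, zetaElt_pow hζ, one_smul, Module.End.one_apply]

/-- The representation `V ⊕_{b₀} ℤ` of `ℤ/p` on `V × ℤ`, for a `ℤ[ζ]`-module `V` and `b₀ ∈ V`:
the standard generator acts by `(b, m) ↦ (ζ b + m b₀, m)`. -/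
def extRep {V : Type*} [AddCommGroup V] [Module (ZZeta ζ) V] (b₀ : V) :
    Representation ℤ (CyclicGrp p) (V × ℤ) :=
  cyclicRep p (extEnd (zetaElt ζ) b₀) <| LinearMap.ext fun x => by
    rw [extEnd_pow_apply, zetaElt_pow hζ, zetaElt_geom_sum hζ]
    simp

/-- The integral representation `ρ` of `ℤ/p` is of type `(a, b, c)`: it is isomorphic to
`(⨁ i < a, Mᵢ) ⊕ (⨁ j < b, Bⱼ ⊕_{βⱼ} ℤ) ⊕ ℤ ^ c`, where the `Mᵢ` and `Bⱼ` are nonzero fractional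
ideals of `ℤ[ζ]` in `ℚ(ζ)` and `βⱼ ∈ Bⱼ` does not lie in `(1 - ζ) Bⱼ`. -/
def IsOfType {L : Type} [AddCommGroup L] (ρ : Representation ℤ (CyclicGrp p) L)
    (a b c : ℕ) : Prop :=
  ∃ (M : Fin a → FractionalIdeal (ZZeta ζ)⁰ K) (B : Fin b → FractionalIdeal (ZZeta ζ)⁰ K)
    (β : ∀ j, (B j : Submodule (ZZeta ζ) K)),
    (∀ i, M i ≠ 0) ∧ (∀ j, B j ≠ 0) ∧
    (∀ j, ∀ x : (B j : Submodule (ZZeta ζ) K), β j ≠ (1 - zetaElt ζ) • x) ∧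
    Nonempty (ρ.Equiv
      (((Representation.directSum fun i => zetaRep hζ (M i : Submodule (ZZeta ζ) K)).prod
        (Representation.directSum fun j => extRep hζ (β j))).prod
          (Representation.trivial ℤ (CyclicGrp p) (Fin c → ℤ))))

/-- The representation `ℤ[ζ] ^ a ⊕ ℤ[ℤ/p] ^ b` of `ℤ/p`. -/
noncomputable def standardRep (a b : ℕ) :
    Representation ℤ (CyclicGrp p)
      ((DirectSum (Fin a) fun _ => ZZeta ζ) ×
        (DirectSum (Fin b) fun _ => MonoidAlgebra ℤ (CyclicGrp p))) :=
  (Representation.directSum fun _ : Fin a => zetaRep hζ (ZZeta ζ)).prod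
    (Representation.directSum fun _ : Fin b => Representation.leftRegular ℤ (CyclicGrp p))

end Reps

/-- The `r`-th exterior power (over `k`) of a representation, with the action
`g (v₁ ∧ ⋯ ∧ vᵣ) = g v₁ ∧ ⋯ ∧ g vᵣ`. -/
noncomputable def exteriorPowerRep {k G V : Type*} [CommRing k] [Monoid G] [AddCommGroup V]
    [Module k V] (ρ : Representation k G V) (r : ℕ) :
    Representation k G (⋀[k]^r V) where
  toFun g := exteriorPower.map r (ρ g)
  map_one' := by
    rw [map_one]
    exact exteriorPower.map_id
  map_mul' g h := by
    rw [map_mul]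
    exact exteriorPower.map_comp _ _

/-! `L` and the standard module are linked by equivariant maps `f`, `g` whose two composites are
multiplication by an integer `N` prime to `p`. Functoriality turns `N` into `N ^ r` on exterior
powers. Tate cohomology of `ℤ/p` is killed by `p` (`tateCohomology_card_zsmul`), so an integer prime
to `p` acts invertibly on it and `f` induces an isomorphism.

The maps come from `exists_linearMap_comp_eq_zsmul`: for `b ∈ B` outside `(1 - ζ)B`, the integral
ideal `b B⁻¹` is not contained in `(1 - ζ)`, the only prime above `p`, so it contains some `N = b y`
prime to `p`. Multiplication by `b` and by `y` then relate `ℤ[ζ]` and `B`. The same maps extend to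
the summands `B ⊕ ℤ`, with `ℤ[ζ] ⊕ ℤ` (extension class `1`) being the regular representation. -/

open CategoryTheory

/-! ### Isogenies of degree prime to `p` and direct sums -/

/-- Two representations over `k` are isogenous of degree prime to `p` if there are equivariant maps
between them in both directions whose composites are both multiplication by the same scalar `N`,
coprime to `p`. -/
def CoprimeIsogenous (p : ℕ) {k G V W : Type*} [CommRing k] [Monoid G]
    [AddCommMonoid V] [Module k V] [AddCommMonoid W] [Module k W]
    (ρ : Representation k G V) (σ : Representation k G W) : Prop :=
  ∃ (N : k) (f : ρ.IntertwiningMap σ) (g : σ.IntertwiningMap ρ), IsCoprime N (p : k) ∧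
    (∀ x, g (f x) = N • x) ∧ ∀ y, f (g y) = N • y

namespace CoprimeIsogenous

variable {p : ℕ} {k G V W U X : Type*} [CommRing k] [Monoid G]
    [AddCommMonoid V] [Module k V] [AddCommMonoid W] [Module k W]
  [AddCommMonoid U] [Module k U] [AddCommMonoid X] [Module k X]
  {ρ : Representation k G V} {σ : Representation k G W}
  {τ : Representation k G U} {υ : Representation k G X}

theorem of_equiv (e : ρ.Equiv σ) : CoprimeIsogenous p ρ σ :=
  ⟨1, e.toIntertwiningMap, e.symm.toIntertwiningMap, isCoprime_one_left,
    fun x => by simp, fun y => by simp⟩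

theorem symm (h : CoprimeIsogenous p ρ σ) : CoprimeIsogenous p σ ρ := by
  obtain ⟨N, f, g, hN, h₁, h₂⟩ := h
  exact ⟨N, g, f, hN, h₂, h₁⟩

theorem trans (h : CoprimeIsogenous p ρ σ) (h' : CoprimeIsogenous p σ τ) :
    CoprimeIsogenous p ρ τ := by
  obtain ⟨N, f, g, hN, h₁, h₂⟩ := h
  obtain ⟨N', f', g', hN', h₁', h₂'⟩ := h'
  refine ⟨N * N', f'.comp f, g.comp g', hN.mul_left hN', fun x => ?_, fun y => ?_⟩
  · simp only [Representation.IntertwiningMap.comp_apply, h₁', map_smul, h₁, smul_smul, mul_comm]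
  · simp only [Representation.IntertwiningMap.comp_apply, h₂, map_smul, h₂', smul_smul]

theorem prod (h : CoprimeIsogenous p ρ σ) (h' : CoprimeIsogenous p τ υ) :
    CoprimeIsogenous p (ρ.prod τ) (σ.prod υ) := by
  obtain ⟨N, f, g, hN, h₁, h₂⟩ := h
  obtain ⟨N', f', g', hN', h₁', h₂'⟩ := h'
  -- The two degrees may differ; scaling each backward map by the other degree makes both composites
  -- `N * N'`.
  refine ⟨N * N', ⟨f.toLinearMap.prodMap f'.toLinearMap, fun s => ?_⟩,
    ⟨(N' • g.toLinearMap).prodMap (N • g'.toLinearMap), fun s => ?_⟩, hN.mul_left hN', ?_, ?_⟩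
  · ext x <;> simp [f.isIntertwining, f'.isIntertwining]
  · ext x <;> simp [g.isIntertwining, g'.isIntertwining]
  · rintro ⟨x, y⟩
    simp [h₁, h₁', smul_smul, mul_comm]
  · rintro ⟨x, y⟩
    simp [h₂, h₂', smul_smul, mul_comm]

variable (p ρ) in
theorem prod_of_unique [Unique W] : CoprimeIsogenous p (ρ.prod σ) ρ :=
  of_equiv (.mk LinearEquiv.prodUnique fun _ => rfl)

theorem directSum {ι : Type*} [Fintype ι] [DecidableEq ι] {A B : ι → Type*}
    [∀ i, AddCommMonoid (A i)] [∀ i, Module k (A i)] [∀ i, AddCommMonoid (B i)]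
    [∀ i, Module k (B i)]
    {α : ∀ i, Representation k G (A i)} {β : ∀ i, Representation k G (B i)}
    (h : ∀ i, CoprimeIsogenous p (α i) (β i)) :
    CoprimeIsogenous p (Representation.directSum α) (Representation.directSum β) := by
  choose N f g hN h₁ h₂ using h
  have key : ∀ i, (∏ j ∈ Finset.univ.erase i, N j) * N i = ∏ j, N j := fun i =>
    Finset.prod_erase_mul _ _ (Finset.mem_univ i)
  refine ⟨∏ i, N i, ⟨DirectSum.lmap fun i => (f i).toLinearMap, fun s => ?_⟩,
    ⟨DirectSum.lmap fun i => (∏ j ∈ Finset.univ.erase i, N j) • (g i).toLinearMap, fun s => ?_⟩,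
    IsCoprime.prod_left fun i _ => hN i, fun x => ?_, fun y => ?_⟩
  · ext i x : 2
    simp [Representation.directSum, DirectSum.lmap_lof, (f i).isIntertwining]
  · ext i x : 2
    simp [Representation.directSum, DirectSum.lmap_lof, (g i).isIntertwining]
  · ext i
    simp [DirectSum.lmap_apply, h₁, smul_smul, key]
    exact (DFinsupp.smul_apply _ x i).symm
  · ext i
    simp [DirectSum.lmap_apply, h₂, smul_smul, key]
    exact (DFinsupp.smul_apply _ y i).symm

end CoprimeIsogenous

/-! ### Exterior powers of isogenies -/

theorem exteriorPower.map_smul_id {k V : Type*} [CommRing k] [AddCommGroup V]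
    [Module k V] (r : ℕ) (N : k) :
    exteriorPower.map r (N • (LinearMap.id : V →ₗ[k] V)) = N ^ r • LinearMap.id := by
  refine exteriorPower.linearMap_ext (AlternatingMap.ext fun v => ?_)
  have := (exteriorPower.ιMulti k r (M := V)).toMultilinearMap.map_smul_univ (fun _ => N) v
  simpa [exteriorPower.map_apply_ιMulti, Function.comp_def] using this

theorem CoprimeIsogenous.exteriorPower {p : ℕ} {k G V W : Type*} [CommRing k] [Monoid G] [AddCommGroup V] [Module k V]
    [AddCommGroup W] [Module k W] {ρ : Representation k G V} {σ : Representation k G W}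
    (h : CoprimeIsogenous p ρ σ) (r : ℕ) :
    CoprimeIsogenous p (exteriorPowerRep ρ r) (exteriorPowerRep σ r) := by
  obtain ⟨N, f, g, hN, h₁, h₂⟩ := h
  have e₁ : g.toLinearMap ∘ₗ f.toLinearMap = N • LinearMap.id := LinearMap.ext h₁
  have e₂ : f.toLinearMap ∘ₗ g.toLinearMap = N • LinearMap.id := LinearMap.ext h₂
  refine ⟨N ^ r, ⟨exteriorPower.map r f.toLinearMap, fun s => ?_⟩,
    ⟨exteriorPower.map r g.toLinearMap, fun s => ?_⟩, hN.pow_left, fun x => ?_, fun y => ?_⟩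
  · change exteriorPower.map r _ ∘ₗ exteriorPower.map r _ =
      exteriorPower.map r _ ∘ₗ exteriorPower.map r _
    rw [← exteriorPower.map_comp, ← exteriorPower.map_comp, f.isIntertwining']
  · change exteriorPower.map r _ ∘ₗ exteriorPower.map r _ =
      exteriorPower.map r _ ∘ₗ exteriorPower.map r _
    rw [← exteriorPower.map_comp, ← exteriorPower.map_comp, g.isIntertwining']
  · have := LinearMap.congr_fun (exteriorPower.map_comp (n := r) f.toLinearMap g.toLinearMap) x
    rw [e₁, exteriorPower.map_smul_id] at this
    exact this.symm
  · have := LinearMap.congr_fun (exteriorPower.map_comp (n := r) g.toLinearMap f.toLinearMap) y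
    rw [e₂, exteriorPower.map_smul_id] at this
    exact this.symm

/-! ### Tate cohomology of a finite cyclic group is killed by the group order -/

theorem CategoryTheory.ShortComplex.moduleCat_zsmul_homology_eq_zero {R : Type*} [Ring R]
    (S : ShortComplex (ModuleCat R)) (c : ℤ)
    (h : ∀ x, S.g x = 0 → ∃ y, S.f y = c • x) (z : S.homology) : c • z = 0 := by
  obtain ⟨y, rfl⟩ := (ModuleCat.epi_iff_surjective S.homologyπ).1 inferInstance z
  obtain ⟨w, hw⟩ := h (S.iCycles y) (by rw [← ConcreteCategory.comp_apply]; simp)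
  have : S.toCycles w = c • y := by
    apply (ModuleCat.mono_iff_injective S.iCycles).1 inferInstance
    rw [← ConcreteCategory.comp_apply, S.toCycles_i, map_zsmul, hw]
  rw [← map_zsmul, ← this, ← ConcreteCategory.comp_apply]
  simp

theorem inhomogeneousCochains_d_zero_apply {k G : Type} [CommRing k] [Group G]
    (A : Rep k G) (x : (Fin 0 → G) → A) (s : G) :
    (inhomogeneousCochains.d A 0).hom x (fun _ => s) = A.ρ s (x default) - x default := by
  rw [inhomogeneousCochains.d_hom_apply]
  simp [← sub_eq_add_neg]
  congr <;> exact Subsingleton.elim _ _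

theorem inhomogeneousChains_d_zero_single {k G : Type} [CommRing k] [Group G] (A : Rep k G)
    (s : G) (a : A) :
    (groupHomology.inhomogeneousChains.d A 0).hom (Finsupp.single (fun _ => s) a) =
      Finsupp.single default (A.ρ s⁻¹ a - a) := by
  rw [groupHomology.inhomogeneousChains.d_single, Finsupp.single_sub]
  simp [← sub_eq_add_neg]
  congr <;> exact Subsingleton.elim _ _

section Tate

variable {k G : Type} [CommRing k] [CommGroup G] [Fintype G] (A : Rep k G) {g : G}

theorem Representation.norm_apply_of_forall_eq {V : Type*} [AddCommGroup V]
    [Module k V] (ρ : Representation k G V) {x : V} (hx : ∀ s, ρ s x = x) :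
    ρ.norm x = (Fintype.card G : ℤ) • x := by
  simp [Representation.norm, LinearMap.sum_apply, hx]

theorem Rep.normHomCompSub_card_smul (hg : ∀ x, x ∈ Subgroup.zpowers g)
    (z : (Rep.FiniteCyclicGroup.normHomCompSub A g).homology) :
    (Fintype.card G : ℤ) • z = 0 := by
  refine ShortComplex.moduleCat_zsmul_homology_eq_zero _ _ (fun x hx => ⟨x, ?_⟩) z
  have hx' : A.ρ g x = x := by
    simpa [Rep.sub_hom, Rep.applyAsHom, sub_eq_zero] using hx
  exact A.ρ.norm_apply_of_forall_eq fun s =>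
    (Representation.mem_invariants_iff_of_forall_mem_zpowers A.ρ g hg x).2 hx' s

/-- When the norm of `x` vanishes, `|G| x = -∑ (s x - x)`, and each `s x - x` lies in the image of
`g - 1` because `g` generates. -/
theorem Representation.exists_sub_eq_card_smul {V : Type*} [AddCommGroup V]
    [Module k V] (ρ : Representation k G V) (hg : ∀ x, x ∈ Subgroup.zpowers g) {x : V} (hx : ρ.norm x = 0) :
    ∃ y, ρ g y - y = (Fintype.card G : ℤ) • x := by
  have h : (Fintype.card G : ℤ) • x ∈ LinearMap.range (ρ g - LinearMap.id) := by
    rw [show (Fintype.card G : ℤ) • x = - ∑ s, (ρ s x - x) by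
      rw [Finset.sum_sub_distrib, ← LinearMap.sum_apply]
      change _ = -(ρ.norm x - _)
      simp [hx]]
    refine neg_mem (sum_mem fun s _ => ?_)
    have := Representation.FiniteCyclicGroup.coinvariantsKer_eq_range ρ g hg
    rw [← this]
    exact Representation.Coinvariants.sub_mem_ker s x
  obtain ⟨y, hy⟩ := h
  exact ⟨y, hy⟩

theorem Rep.subCompNormHom_card_smul (hg : ∀ x, x ∈ Subgroup.zpowers g)
    (z : (Rep.FiniteCyclicGroup.subCompNormHom A g).homology) :
    (Fintype.card G : ℤ) • z = 0 := by
  refine ShortComplex.moduleCat_zsmul_homology_eq_zero _ _ (fun x hx => ?_) z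
  obtain ⟨y, hy⟩ := A.ρ.exists_sub_eq_card_smul hg hx
  exact ⟨y, by simpa [Rep.sub_hom, Rep.applyAsHom] using hy⟩

theorem ModuleCat.zsmul_eq_zero_of_iso {R : Type*} [Ring R] {M N : ModuleCat R} (e : M ≅ N)
    {c : ℤ} (h : ∀ z : N, c • z = 0) (z : M) : c • z = 0 := by
  apply e.toLinearEquiv.injective
  rw [map_zsmul, map_zero, h]

theorem tateCohomology_zero_card_zsmul (z : tateCohomology A 0) :
    (Fintype.card G : ℤ) • z = 0 := by
  refine ModuleCat.zsmul_eq_zero_of_iso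
    ((tateComplex A).homologyIsoSc' (-1) 0 1 (by simp) (by simp)) (fun z => ?_) z
  refine ShortComplex.moduleCat_zsmul_homology_eq_zero _ _ (fun x hx => ?_) z
  change (Fin 0 → G) → A at x
  change (groupCohomology.inhomogeneousCochains A).d 0 1 x = 0 at hx
  rw [groupCohomology.inhomogeneousCochains.d_def] at hx
  have hx' : ∀ s, A.ρ s (x default) = x default := fun s => by
    have := congrFun hx fun _ => s
    rw [inhomogeneousCochains_d_zero_apply] at this
    exact sub_eq_zero.1 this
  refine ⟨Finsupp.single default (x default), ?_⟩
  change A.tateNorm _ = _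
  rw [Rep.tateNorm_eq]
  ext i
  have := A.ρ.norm_apply_of_forall_eq hx'
  obtain rfl := Subsingleton.elim i default
  simp only [ConcreteCategory.hom_ofHom, Finsupp.lsum_single, LinearMap.pi_apply, this]
  rfl

theorem tateCohomology_neg_one_card_zsmul (hg : ∀ x, x ∈ Subgroup.zpowers g)
    (z : tateCohomology A (-1)) : (Fintype.card G : ℤ) • z = 0 := by
  refine ModuleCat.zsmul_eq_zero_of_iso
    ((tateComplex A).homologyIsoSc' (-2) (-1) 0 (by simp) (by simp)) (fun z => ?_) z
  refine ShortComplex.moduleCat_zsmul_homology_eq_zero _ _ (fun x hx => ?_) z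
  change (Fin 0 → G) →₀ A at x
  change A.tateNorm x = 0 at hx
  rw [Rep.tateNorm_eq] at hx
  obtain ⟨a, rfl⟩ : ∃ a, x = Finsupp.single default a := ⟨_, Finsupp.unique_single x⟩
  have hx' : A.ρ.norm a = 0 := by
    have := congrFun hx default
    simp only [ConcreteCategory.hom_ofHom, Finsupp.lsum_single, LinearMap.pi_apply] at this
    exact this
  obtain ⟨y, hy⟩ := A.ρ.exists_sub_eq_card_smul hg hx'
  -- The chain differential acts through the inverse of the group element, hence `g⁻¹`.
  refine ⟨Finsupp.single (fun _ => g⁻¹) y, ?_⟩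
  change (groupHomology.inhomogeneousChains A).d 1 0 _ = _
  rw [groupHomology.inhomogeneousChains.d_def]
  rw [inhomogeneousChains_d_zero_single, inv_inv, hy]
  exact (Finsupp.smul_single _ _ _).symm

/-- Degrees `0` and `-1` are adjacent to the norm map of the Tate complex and are treated directly;
all others reduce to the two-periodic complexes built from the norm and `g - 1`. -/
theorem tateCohomology_card_zsmul (hg : ∀ x, x ∈ Subgroup.zpowers g) (n : ℤ)
    (z : tateCohomology A n) : (Fintype.card G : ℤ) • z = 0 := by
  classical
  obtain ⟨n, rfl | rfl⟩ : ∃ m : ℕ, n = m ∨ n = -(m + 1) := by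
    rcases n with m | m
    · exact ⟨m, .inl rfl⟩
    · exact ⟨m, .inr (Int.negSucc_eq m)⟩
  · rcases Nat.eq_zero_or_pos n with rfl | hn
    · exact tateCohomology_zero_card_zsmul A z
    have : NeZero n := ⟨hn.ne'⟩
    refine ModuleCat.zsmul_eq_zero_of_iso
      ((TateCohomology.isoGroupCohomology n).app A) (fun z => ?_) z
    rcases Nat.even_or_odd n with h | h
    · exact ModuleCat.zsmul_eq_zero_of_iso (Rep.FiniteCyclicGroup.groupCohomologyIsoEven A g hg n h)
        (A.normHomCompSub_card_smul hg) z
    · exact ModuleCat.zsmul_eq_zero_of_iso (Rep.FiniteCyclicGroup.groupCohomologyIsoOdd A g hg n h)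
        (A.subCompNormHom_card_smul hg) z
  · rcases Nat.eq_zero_or_pos n with rfl | hn
    · exact tateCohomology_neg_one_card_zsmul A hg z
    have : NeZero n := ⟨hn.ne'⟩
    refine ModuleCat.zsmul_eq_zero_of_iso
      ((TateCohomology.isoGroupHomology _ n rfl).app A) (fun z => ?_) z
    rcases Nat.even_or_odd n with h | h
    · exact ModuleCat.zsmul_eq_zero_of_iso (Rep.FiniteCyclicGroup.groupHomologyIsoEven A g hg n h)
        (A.subCompNormHom_card_smul hg) z
    · exact ModuleCat.zsmul_eq_zero_of_iso (Rep.FiniteCyclicGroup.groupHomologyIsoOdd A g hg n h)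
        (A.normHomCompSub_card_smul hg) z

end Tate

instance tateCohomologyFunctor_additive {R G : Type} [CommRing R] [Group G] [Fintype G] (n : ℤ) :
    (tateCohomologyFunctor (R := R) (G := G) n).Additive := by
  unfold tateCohomologyFunctor
  infer_instance

/-- With `u N + v p = 1` and `p` acting as zero, `u` times the map induced by `g` inverts the map
induced by `f`. -/
theorem CoprimeIsogenous.nonempty_tateCohomology_iso {p : ℕ} [Fact p.Prime] {V W : Type}
    [AddCommGroup V] [Module ℤ V] [AddCommGroup W] [Module ℤ W] {ρ : Representation ℤ (CyclicGrp p) V}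
    {σ : Representation ℤ (CyclicGrp p) W} (h : CoprimeIsogenous p ρ σ) (n : ℤ) :
    Nonempty (tateCohomology (Rep.of ρ) n ≅ tateCohomology (Rep.of σ) n) := by
  obtain ⟨N, f, g, ⟨u, v, huv⟩, h₁, h₂⟩ := h
  let H := tateCohomologyFunctor (R := ℤ) (G := CyclicGrp p) n
  have hp : ∀ (A : Rep ℤ (CyclicGrp p)), (p : ℤ) • 𝟙 (H.obj A) = 0 := fun A => by
    ext z
    have hgen : ∀ x : CyclicGrp p, x ∈ Subgroup.zpowers (Multiplicative.ofAdd (1 : ZMod p)) :=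
      fun x => ⟨(Multiplicative.toAdd x).val, by
        change _ ^ ((_ : ℕ) : ℤ) = x
        rw [zpow_natCast, ← ofAdd_nsmul, nsmul_one, ZMod.natCast_zmod_val, ofAdd_toAdd]⟩
    have := tateCohomology_card_zsmul A hgen n z
    rw [Fintype.card_multiplicative, ZMod.card] at this
    simpa using this
  have key : ∀ (A : Rep ℤ (CyclicGrp p)) (e : A ⟶ A), e = N • 𝟙 A → u • H.map e = 𝟙 _ := by
    rintro A _ rfl
    have : (u * N + v * p) • 𝟙 (H.obj A) = 𝟙 (H.obj A) := by rw [huv, one_smul]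
    rwa [add_smul, mul_smul v, hp, smul_zero, add_zero, mul_smul, ← H.map_id,
      ← Functor.map_zsmul, H.map_id] at this
  refine ⟨⟨H.map (Rep.ofHom f), u • H.map (Rep.ofHom g), ?_, ?_⟩⟩
  · rw [Preadditive.comp_zsmul, ← H.map_comp]
    exact key _ _ (by ext x; exact (h₁ x).trans (int_smul_eq_zsmul _ _ _))
  · rw [Preadditive.zsmul_comp, ← H.map_comp]
    exact key _ _ (by ext x; exact (h₂ x).trans (int_smul_eq_zsmul _ _ _))

/-! ### Arithmetic of `ℤ[ζ]` at `1 - ζ` -/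

section Arithmetic

variable {p : ℕ} [Fact p.Prime] {K : Type} [Field K] {ζ : K}

/-- Every element of `ℤ[ζ]` is congruent to an integer modulo `1 - ζ`. -/
theorem exists_int_sub_mem_span (x : ZZeta ζ) :
    ∃ k : ℤ, x - k ∈ Ideal.span {1 - zetaElt ζ} := by
  obtain ⟨x, hx⟩ := x
  induction hx using Algebra.adjoin_induction with
  | mem y hy =>
    obtain rfl : y = ζ := hy
    refine ⟨1, Ideal.mem_span_singleton.2 ⟨-1, ?_⟩⟩
    apply Subtype.ext
    simp [zetaElt]
  | algebraMap r => exact ⟨r, by convert Ideal.zero_mem _ using 1; apply Subtype.ext; simp⟩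
  | add y z hy hz h₁ h₂ =>
    obtain ⟨k, hk⟩ := h₁
    obtain ⟨l, hl⟩ := h₂
    refine ⟨k + l, ?_⟩
    convert Ideal.add_mem _ hk hl using 1
    apply Subtype.ext
    simp
    ring
  | mul y z hy hz h₁ h₂ =>
    obtain ⟨k, hk⟩ := h₁
    obtain ⟨l, hl⟩ := h₂
    refine ⟨k * l, ?_⟩
    convert Ideal.add_mem _ (Ideal.mul_mem_right ⟨z, hz⟩ _ hk) (Ideal.mul_mem_left _ (k : ZZeta ζ) hl)
      using 1
    apply Subtype.ext
    simp
    ring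

theorem natCast_mem_span_one_sub_zeta (hζ : IsPrimitiveRoot ζ p) :
    (p : ZZeta ζ) ∈ Ideal.span {1 - zetaElt ζ} := by
  rw [← Ideal.Quotient.eq_zero_iff_mem]
  have h : Ideal.Quotient.mk (Ideal.span {1 - zetaElt ζ}) (zetaElt ζ) = 1 := by
    rw [← map_one (Ideal.Quotient.mk _), eq_comm, Ideal.Quotient.eq]
    exact Ideal.mem_span_singleton_self _
  simpa [h] using congrArg (Ideal.Quotient.mk (Ideal.span {1 - zetaElt ζ})) (zetaElt_geom_sum hζ)

/-- Modulo `p`, `1 = ((1 - ζ) + ζ) ^ p` is `(1 - ζ) ^ p + ζ ^ p = (1 - ζ) ^ p + 1`. -/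
theorem natCast_dvd_one_sub_zeta_pow (hζ : IsPrimitiveRoot ζ p) :
    (p : ZZeta ζ) ∣ (1 - zetaElt ζ) ^ p := by
  obtain ⟨r, hr⟩ := exists_add_pow_prime_eq (Fact.out : p.Prime) (1 - zetaElt ζ) (zetaElt ζ)
  rw [sub_add_cancel, one_pow, zetaElt_pow hζ] at hr
  exact ⟨-((1 - zetaElt ζ) * zetaElt ζ * r), by linear_combination -hr⟩

/-- An ideal of `ℤ[ζ]` not contained in `(1 - ζ)` contains an integer prime to `p`. -/
theorem exists_int_mem_of_not_le [IsDedekindDomain (ZZeta ζ)] [Module.Finite ℤ (ZZeta ζ)]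
    [Module.Free ℤ (ZZeta ζ)] (hζ : IsPrimitiveRoot ζ p) (I : Ideal (ZZeta ζ))
    (hI : ¬ I ≤ Ideal.span {1 - zetaElt ζ}) :
    ∃ N : ℤ, IsCoprime N (p : ℤ) ∧ (N : ZZeta ζ) ∈ I := by
  obtain ⟨a, ha, haP⟩ := Set.not_subset.1 hI
  obtain ⟨k, hk⟩ := exists_int_sub_mem_span a
  have hp := natCast_mem_span_one_sub_zeta hζ
  have hkp : IsCoprime k (p : ℤ) := by
    rw [isCoprime_comm, Prime.coprime_iff_not_dvd (Nat.prime_iff_prime_int.1 Fact.out)]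
    rintro ⟨m, rfl⟩
    refine haP ?_
    have := Ideal.add_mem _ hk (Ideal.mul_mem_right (m : ZZeta ζ) _ hp)
    simpa using this
  have h₁ : IsCoprime I (Ideal.span {1 - zetaElt ζ}) := by
    rw [Ideal.isCoprime_iff_exists]
    obtain ⟨u, v, huv⟩ := hkp
    refine ⟨u * a, Ideal.mul_mem_left _ _ ha, 1 - u * a, ?_, by ring⟩
    have e : (1 : ZZeta ζ) = u * k + v * p := by
      have := congrArg (Int.cast : ℤ → ZZeta ζ) huv
      push_cast at this
      exact this.symm
    have := Ideal.sub_mem _ (Ideal.mul_mem_left _ (v : ZZeta ζ) hp)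
      (Ideal.mul_mem_left _ (u : ZZeta ζ) hk)
    convert this using 1
    rw [e]
    ring
  have h₂ : IsCoprime I (Ideal.span {(p : ZZeta ζ)}) := by
    have := (h₁.pow_right (n := p))
    rw [Ideal.span_singleton_pow, Ideal.isCoprime_iff_sup_eq] at this
    rw [Ideal.isCoprime_iff_sup_eq, eq_top_iff, ← this]
    exact sup_le_sup_left (Ideal.span_singleton_le_span_singleton.2
      (natCast_dvd_one_sub_zeta_pow hζ)) _
  obtain ⟨i, hi, j, hj, hij⟩ := Ideal.isCoprime_iff_exists.1 h₂
  obtain ⟨c, rfl⟩ := Ideal.mem_span_singleton.1 hj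
  -- The integer is the index of `I`. If `p` divided it, Cauchy's theorem would give an element of
  -- order `p` in the quotient, where `p` is a unit.
  refine ⟨Ideal.absNorm I, ?_, by exact_mod_cast Ideal.absNorm_mem I⟩
  rw [Nat.isCoprime_iff_coprime, Nat.coprime_comm, Nat.Prime.coprime_iff_not_dvd Fact.out]
  intro hdvd
  have hI0 : Finite (ZZeta ζ ⧸ I) :=
    Ideal.finiteQuotientOfFreeOfNeBot I (by rintro rfl; exact hI bot_le)
  rw [Ideal.absNorm_apply, Submodule.cardQuot_apply] at hdvd
  obtain ⟨x, hx⟩ := exists_prime_addOrderOf_dvd_card' p hdvd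
  have hpx : (p : ZZeta ζ ⧸ I) * x = 0 := by
    rw [← nsmul_eq_mul, ← hx, addOrderOf_nsmul_eq_zero]
  have hu : (p : ZZeta ζ ⧸ I) * Ideal.Quotient.mk I c = 1 := by
    have := congrArg (Ideal.Quotient.mk I) hij
    rw [map_add, Ideal.Quotient.eq_zero_iff_mem.2 hi] at this
    simpa using this
  have : x = 0 := by linear_combination (Ideal.Quotient.mk I c) * hpx - x * hu
  rw [this, addOrderOf_zero] at hx
  exact (Fact.out : p.Prime).one_lt.ne hx

end Arithmetic

theorem ZZeta_finite {p : ℕ} [Fact p.Prime] {K : Type} [Field K] {ζ : K}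
    (hζ : IsPrimitiveRoot ζ p) : Module.Finite ℤ (ZZeta ζ) :=
  Algebra.finite_adjoin_simple_of_isIntegral (hζ.isIntegral (Fact.out : p.Prime).pos)

theorem finrank_ZZeta {p : ℕ} [Fact p.Prime] {K : Type} [Field K] [CharZero K] {ζ : K}
    (hζ : IsPrimitiveRoot ζ p) : Module.finrank ℤ (ZZeta ζ) = p - 1 := by
  have hp : p.Prime := Fact.out
  rw [(Algebra.adjoin.powerBasis' (hζ.isIntegral hp.pos)).finrank, Algebra.adjoin.powerBasis'_dim,
    ← Polynomial.cyclotomic_eq_minpoly hζ hp.pos, Polynomial.natDegree_cyclotomic,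
    Nat.totient_prime hp]

/-! ### Embedding `ℤ[ζ]` in a fractional ideal with index prime to `p` -/

section FractionalIdeals

variable {p : ℕ} [Fact p.Prime] {K : Type} [Field K] {ζ : K}

theorem not_isUnit_one_sub_zetaElt [CharZero K] (hζ : IsPrimitiveRoot ζ p) :
    ¬ IsUnit (1 - zetaElt ζ) := fun h => by
  have hp : p.Prime := Fact.out
  have hu : IsUnit (p : ZZeta ζ) := isUnit_of_dvd_unit (natCast_dvd_one_sub_zeta_pow hζ) (h.pow p)
  have := ZZeta_finite hζ
  have hu' : IsUnit (algebraMap ℤ (ZZeta ζ) p) := by simpa using hu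
  exact (Nat.prime_iff_prime_int.1 hp).not_isUnit (isUnit_of_map_unit _ _ hu')

variable [IsDedekindDomain (ZZeta ζ)] [IsFractionRing (ZZeta ζ) K]

/-- If `B = (1 - ζ)B`, cancelling `B` would make `1 - ζ` a unit. This supplies a base element for
the summands `Mᵢ`, which carry none. -/
theorem exists_ne_one_sub_zetaElt_smul [CharZero K] (hζ : IsPrimitiveRoot ζ p)
    (B : FractionalIdeal (ZZeta ζ)⁰ K) (hB : B ≠ 0) :
    ∃ b : (B : Submodule (ZZeta ζ) K), ∀ x : (B : Submodule (ZZeta ζ) K),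
      b ≠ (1 - zetaElt ζ) • x := by
  by_contra! h
  refine not_isUnit_one_sub_zetaElt hζ ?_
  have h₁ : B ≤ FractionalIdeal.spanSingleton (ZZeta ζ)⁰
      (algebraMap (ZZeta ζ) K (1 - zetaElt ζ)) * B := fun b hb => by
    obtain ⟨⟨x, hx⟩, hbx⟩ := h ⟨b, hb⟩
    exact FractionalIdeal.mem_singleton_mul.2 ⟨x, hx, congrArg Subtype.val hbx⟩
  have h₂ := mul_le_mul_left h₁ B⁻¹
  rw [mul_assoc, mul_inv_cancel₀ hB, mul_one, ← FractionalIdeal.coeIdeal_span_singleton,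
    ← FractionalIdeal.coeIdeal_top, FractionalIdeal.coeIdeal_le_coeIdeal, top_le_iff] at h₂
  exact Ideal.span_singleton_eq_top.1 h₂

theorem exists_mul_eq_intCast [Module.Finite ℤ (ZZeta ζ)] [Module.Free ℤ (ZZeta ζ)]
    (hζ : IsPrimitiveRoot ζ p) (B : FractionalIdeal (ZZeta ζ)⁰ K) (hB : B ≠ 0)
    (b : (B : Submodule (ZZeta ζ) K))
    (hb : ∀ x : (B : Submodule (ZZeta ζ) K), b ≠ (1 - zetaElt ζ) • x) :
    ∃ N : ℤ, IsCoprime N (p : ℤ) ∧ ∃ y ∈ B⁻¹, (b : K) * y = N := by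
  have hJ : FractionalIdeal.spanSingleton (ZZeta ζ)⁰ (b : K) * B⁻¹ ≤ 1 := by
    rw [← mul_inv_cancel₀ hB]
    exact mul_le_mul_left (FractionalIdeal.spanSingleton_le_iff_mem.2 b.2) _
  obtain ⟨I, hI⟩ := FractionalIdeal.le_one_iff_exists_coeIdeal.1 hJ
  obtain ⟨N, hN, hNI⟩ := exists_int_mem_of_not_le hζ I fun hle => by
    have h₁ : (I : FractionalIdeal (ZZeta ζ)⁰ K) * B ≤
        (Ideal.span {1 - zetaElt ζ} : Ideal (ZZeta ζ)) * B :=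
      mul_le_mul_left ((FractionalIdeal.coeIdeal_le_coeIdeal K).2 hle) _
    rw [hI, mul_assoc, inv_mul_cancel₀ hB, mul_one, FractionalIdeal.spanSingleton_le_iff_mem,
      FractionalIdeal.coeIdeal_span_singleton, FractionalIdeal.mem_singleton_mul] at h₁
    obtain ⟨x, hx, hbx⟩ := h₁
    exact hb ⟨x, hx⟩ (Subtype.ext hbx)
  have : (N : K) ∈ (I : FractionalIdeal (ZZeta ζ)⁰ K) :=
    (FractionalIdeal.mem_coeIdeal _).2 ⟨N, hNI, by simp⟩
  rw [hI, FractionalIdeal.mem_singleton_mul] at this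
  obtain ⟨y, hy, h⟩ := this
  exact ⟨N, hN, y, hy, h.symm⟩

/-- An element of a fractional ideal `B` outside `(1 - ζ) B` gives an embedding of `ℤ[ζ]` in `B` of
index prime to `p`. -/
theorem exists_linearMap_comp_eq_zsmul [Module.Finite ℤ (ZZeta ζ)] [Module.Free ℤ (ZZeta ζ)]
    (hζ : IsPrimitiveRoot ζ p) (B : FractionalIdeal (ZZeta ζ)⁰ K) (hB : B ≠ 0)
    (b : (B : Submodule (ZZeta ζ) K))
    (hb : ∀ x : (B : Submodule (ZZeta ζ) K), b ≠ (1 - zetaElt ζ) • x) :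
    ∃ (N : ℤ) (φ : ZZeta ζ →ₗ[ZZeta ζ] (B : Submodule (ZZeta ζ) K))
      (ψ : (B : Submodule (ZZeta ζ) K) →ₗ[ZZeta ζ] ZZeta ζ), IsCoprime N (p : ℤ) ∧ φ 1 = b ∧
      (∀ r, ψ (φ r) = N • r) ∧ ∀ x, φ (ψ x) = N • x := by
  obtain ⟨N, hN, y, hy, hby⟩ := exists_mul_eq_intCast hζ B hB b hb
  have hmem : ∀ x : (B : Submodule (ZZeta ζ) K), y * x ∈ Algebra.adjoin ℤ ({ζ} : Set K) := fun x => by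
    obtain ⟨r, hr⟩ := (FractionalIdeal.mem_one_iff _).1
      ((FractionalIdeal.mem_inv_iff hB).1 hy x x.2)
    exact hr ▸ r.2
  -- Multiplication by `y ∈ B⁻¹`, which maps `B` into `ℤ[ζ]`.
  let ψ : (B : Submodule (ZZeta ζ) K) →ₗ[ZZeta ζ] ZZeta ζ :=
    { toFun := fun x => ⟨y * x, hmem x⟩
      map_add' := fun x z => Subtype.ext (mul_add _ _ _)
      map_smul' := fun r x => Subtype.ext (mul_left_comm y (r : K) (x : K)) }
  refine ⟨N, LinearMap.toSpanSingleton _ _ b, ψ, hN, one_smul _ _, fun r => ?_, fun x => ?_⟩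
  · apply Subtype.ext
    change y * ((r : K) * b) = ((N • r : ZZeta ζ) : K)
    rw [zsmul_eq_mul]
    push_cast
    rw [← hby]
    ring
  · apply Subtype.ext
    change (y * x) * b = ((N • x : (B : Submodule (ZZeta ζ) K)) : K)
    rw [Submodule.coe_smul_of_tower, zsmul_eq_mul, ← hby]
    ring

end FractionalIdeals

/-! ### Isogenies between the indecomposable summands -/

section Isogenies

variable {p : ℕ} [Fact p.Prime]

theorem cyclicRep_isIntertwining {V W : Type*} [AddCommGroup V] [AddCommGroup W]
    {T : Module.End ℤ V} (hT : T ^ p = 1) {S : Module.End ℤ W} (hS : S ^ p = 1) (f : V →ₗ[ℤ] W)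
    (h : f ∘ₗ T = S ∘ₗ f) (s : CyclicGrp p) :
    f ∘ₗ cyclicRep p T hT s = cyclicRep p S hS s ∘ₗ f := by
  change f ∘ₗ (T ^ _) = (S ^ _) ∘ₗ f
  generalize (Multiplicative.toAdd s).val = n
  induction n with
  | zero => rfl
  | succ n ih =>
    rw [pow_succ, pow_succ, Module.End.mul_eq_comp, ← LinearMap.comp_assoc, ih,
      LinearMap.comp_assoc, h, Module.End.mul_eq_comp, LinearMap.comp_assoc]

variable {K : Type} [Field K] {ζ : K}

theorem coprimeIsogenous_zetaRep (hζ : IsPrimitiveRoot ζ p) {V : Type} [AddCommGroup V]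
    [Module (ZZeta ζ) V] {N : ℤ} (hN : IsCoprime N (p : ℤ)) (φ : ZZeta ζ →ₗ[ZZeta ζ] V)
    (ψ : V →ₗ[ZZeta ζ] ZZeta ζ) (h₁ : ∀ r, ψ (φ r) = N • r) (h₂ : ∀ x, φ (ψ x) = N • x) :
    CoprimeIsogenous p (zetaRep hζ V) (zetaRep hζ (ZZeta ζ)) :=
  ⟨N, ⟨ψ.toAddMonoidHom.toIntLinearMap, cyclicRep_isIntertwining _ _ _ <|
      LinearMap.ext fun x => ψ.map_smul _ x⟩,
    ⟨φ.toAddMonoidHom.toIntLinearMap, cyclicRep_isIntertwining _ _ _ <|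
      LinearMap.ext fun x => φ.map_smul _ x⟩, hN, h₂, h₁⟩

/-- Since `φ` matches the extension classes, it extends by the identity on `ℤ`; since `ψ (φ 1) = N`,
`ψ` must be extended by `N`. -/
theorem coprimeIsogenous_extRep (hζ : IsPrimitiveRoot ζ p) {V : Type} [AddCommGroup V]
    [Module (ZZeta ζ) V] {N : ℤ} (hN : IsCoprime N (p : ℤ)) (φ : ZZeta ζ →ₗ[ZZeta ζ] V)
    (ψ : V →ₗ[ZZeta ζ] ZZeta ζ) (h₁ : ∀ r, ψ (φ r) = N • r) (h₂ : ∀ x, φ (ψ x) = N • x) :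
    CoprimeIsogenous p (extRep hζ (φ 1)) (extRep hζ (1 : ZZeta ζ)) := by
  refine ⟨N, ⟨ψ.toAddMonoidHom.toIntLinearMap.prodMap (N • LinearMap.id),
      cyclicRep_isIntertwining _ _ _ <| LinearMap.ext fun x => ?_⟩,
    ⟨φ.toAddMonoidHom.toIntLinearMap.prodMap LinearMap.id,
      cyclicRep_isIntertwining _ _ _ <| LinearMap.ext fun x => ?_⟩, hN, fun x => ?_, fun x => ?_⟩
  · refine Prod.ext ?_ rfl
    change ψ (zetaElt ζ • x.1 + x.2 • φ 1) = zetaElt ζ • ψ x.1 + (N • x.2) • (1 : ZZeta ζ)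
    rw [map_add, map_smul, map_zsmul, h₁, smul_assoc, smul_comm]
  · refine Prod.ext ?_ rfl
    change φ (zetaElt ζ • x.1 + x.2 • (1 : ZZeta ζ)) = zetaElt ζ • φ x.1 + x.2 • φ 1
    rw [map_add, map_smul, map_zsmul]
  · exact Prod.ext (h₂ x.1) rfl
  · exact Prod.ext (h₁ x.1) rfl

/-- The regular representation of `ℤ/p` is the extension `ℤ[ζ] ⊕₁ ℤ`. -/
theorem nonempty_leftRegular_equiv_extRep [CharZero K] (hζ : IsPrimitiveRoot ζ p) :
    Nonempty ((Representation.leftRegular ℤ (CyclicGrp p)).Equiv (extRep hζ (1 : ZZeta ζ))) := by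
  have hp : p.Prime := Fact.out
  have := ZZeta_finite hζ
  let F := (Representation.leftRegularMapEquiv (extRep hζ (1 : ZZeta ζ))).symm (0, 1)
  have hF : ∀ s, F (MonoidAlgebra.single s 1) = extRep hζ (1 : ZZeta ζ) s (0, 1) :=
    fun s => Representation.leftRegularMapEquiv_symm_single _ s _
  have h0 : ((0, 1) : ZZeta ζ × ℤ) ∈ LinearMap.range F.toLinearMap :=
    ⟨MonoidAlgebra.single 1 1, by rw [F.toLinearMap_apply, hF, map_one]; rfl⟩
  have hgen : ∀ x : ZZeta ζ × ℤ, extRep hζ (1 : ZZeta ζ) (Multiplicative.ofAdd 1) x =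
      extEnd (zetaElt ζ) 1 x := fun x => by rw [extRep, cyclicRep_generator]
  have hstep : ∀ x ∈ LinearMap.range F.toLinearMap,
      extEnd (zetaElt ζ) 1 x ∈ LinearMap.range F.toLinearMap := by
    rintro _ ⟨y, rfl⟩
    rw [← hgen]
    exact ⟨_, Representation.IntertwiningMap.isIntertwining _ _ F _ y⟩
  -- `(t - 1)(0, 1) = (1, 0)`.
  have h1 : ((1, 0) : ZZeta ζ × ℤ) ∈ LinearMap.range F.toLinearMap := by
    simpa using sub_mem (hstep _ h0) h0
  have key : ∀ r s : ZZeta ζ, (s, (0 : ℤ)) ∈ LinearMap.range F.toLinearMap →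
      (r * s, (0 : ℤ)) ∈ LinearMap.range F.toLinearMap := by
    rintro ⟨r, hr⟩
    induction hr using Algebra.adjoin_induction with
    | mem y hy =>
      obtain rfl : y = ζ := hy
      intro s hs
      simpa [zetaElt] using hstep _ hs
    | algebraMap r =>
      intro s hs
      have := Submodule.smul_mem _ r hs
      rw [Prod.smul_mk, smul_zero, Algebra.smul_def] at this
      exact this
    | add y z hy hz h₁ h₂ =>
      intro s hs
      have := add_mem (h₁ s hs) (h₂ s hs)
      rw [Prod.mk_add_mk, add_zero, ← add_mul] at this
      exact this
    | mul y z hy hz h₁ h₂ =>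
      intro s hs
      have := h₁ _ (h₂ s hs)
      rw [← mul_assoc] at this
      exact this
  have hsurj : Function.Surjective F.toLinearMap := by
    rintro ⟨r, m⟩
    have := add_mem (key r 1 h1) (Submodule.smul_mem _ m h0)
    simpa using this
  let b := MonoidAlgebra.basis (CyclicGrp p) ℤ
  have : Module.Free ℤ (MonoidAlgebra ℤ (CyclicGrp p)) := .of_basis b
  have : Module.Finite ℤ (MonoidAlgebra ℤ (CyclicGrp p)) := .of_basis b
  -- Both sides have rank `p = (p - 1) + 1`, so surjectivity suffices.
  have hbij := OrzechProperty.bijective_of_surjective_of_finrank_le F.toLinearMap hsurj (by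
    rw [Module.finrank_eq_card_basis b, Module.finrank_prod, finrank_ZZeta hζ,
      Module.finrank_self, Fintype.card_multiplicative, ZMod.card]
    omega)
  exact ⟨.mk (LinearEquiv.ofBijective _ hbij) F.isIntertwining'⟩

end Isogenies

/-! ### Assembly -/

theorem mainTheorem12 {p : ℕ} [Fact p.Prime] {K : Type} [Field K] [CharZero K]
    [IsCyclotomicExtension {p} ℚ K] {ζ : K} (hζ : IsPrimitiveRoot ζ p)
    {L : Type} [AddCommGroup L] (ρ : Representation ℤ (CyclicGrp p) L)
    (a b : ℕ) (hL : IsOfType hζ ρ a b 0) (r : ℕ) (n : ℤ) :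
    Nonempty (CategoryTheory.Iso
      (tateCohomology (Rep.of (exteriorPowerRep ρ r)) n)
      (tateCohomology (Rep.of (exteriorPowerRep (standardRep hζ a b) r)) n)) := by
  have := IsCyclotomicExtension.Rat.isIntegralClosure_adjoin_singleton_of_prime hζ
  have := IsCyclotomicExtension.finiteDimensional {p} ℚ K
  have : IsDedekindDomain (ZZeta ζ) := IsIntegralClosure.isDedekindDomain ℤ ℚ K _
  have : IsFractionRing (ZZeta ζ) K :=
    IsIntegralClosure.isFractionRing_of_finite_extension ℤ ℚ K _
  have := ZZeta_finite hζ
  obtain ⟨M, B, β, hM, hB, hβ, ⟨e⟩⟩ := hL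
  suffices h : CoprimeIsogenous p ρ (standardRep hζ a b) from
    (h.exteriorPower r).nonempty_tateCohomology_iso n
  -- The trivial summand has rank `c = 0` and is dropped.
  refine (CoprimeIsogenous.of_equiv e).trans ((CoprimeIsogenous.prod_of_unique p _).trans ?_)
  refine CoprimeIsogenous.prod (.directSum fun i => ?_) (.directSum fun j => ?_)
  · obtain ⟨b, hb⟩ := exists_ne_one_sub_zetaElt_smul hζ (M i) (hM i)
    obtain ⟨N, φ, ψ, hN, -, h₁, h₂⟩ := exists_linearMap_comp_eq_zsmul hζ (M i) (hM i) b hb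
    exact coprimeIsogenous_zetaRep hζ hN φ ψ h₁ h₂
  · obtain ⟨N, φ, ψ, hN, hφ, h₁, h₂⟩ := exists_linearMap_comp_eq_zsmul hζ (B j) (hB j) _ (hβ j)
    obtain ⟨e'⟩ := nonempty_leftRegular_equiv_extRep hζ
    rw [← hφ]
    exact (coprimeIsogenous_extRep hζ hN φ ψ h₁ h₂).trans (CoprimeIsogenous.of_equiv e').symm
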